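/- Let $|\theta|_o=|\bar\theta|$, where $\bar\theta\in(-\pi,\pi]$ is the representative of $\theta\in\mathbb R$ modulo $2\pi$, and let $h(\theta)=\sin\theta/|\theta|_o$ (with $h=0$ on $2\pi\mathbb Z$) be the critical ($\alpha=\tfrac12$) singular interaction kernel. Let $K>0$, let $\Omega_1=\dots=\Omega_N$ be identical natural frequencies (e.g. $\Omega_i=0$), and let $H:\mathbb R^N\to\mathbb R^N$ be given by $$H_i(\Theta)=\Omega_i+\frac KN\sum_{j=1}^N h(\theta_j-\theta_i),\qquad i=1,\dots,N .$$ Its Filippov set-valued map is $$\mathcal H(\Theta)=\bigcap_{\delta>0}\ \bigcap_{|\mathcal N|=0}\overline{\mathrm{co}}\big(H(B_\delta(\Theta)\setminus\mathcal N)\big).$$ A Filippov solution with initial datum $\Theta_0$ is a curve $\Theta=(\theta_1,\dots,\theta_N):[0,\infty)\to\mathbb R^N$ which is absolutely continuous on bounded intervals, with $\Theta(0)=\Theta_0$ and $\dot\Theta(t)\in\mathcal H(\Theta(t))$ for a.e. $t\ge 0$. Write $D(\Theta)=\max_i\theta_i-\min_i\theta_i$. **Theorem.** Let $\Theta$ be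 a Filippov solution with initial datum $\Theta_0$ satisfying $0<D(\Theta_0)<\pi$. Then complete phase synchronization takes place in finite time, not later than $$T_c=\frac{D(\Theta_0)}{K\,h(D(\Theta_0))}:$$ there is $T\in(0,T_c]$ such that $\lim_{t\to T^-}|\theta_i(t)-\theta_j(t)|=0$ for all $i\ne j$, and $\theta_i(t)=\theta_j(t)$ for all $i,j$ and all $t\ge T$. -/

import Mathlib

open MeasureTheory Filter Topology

namespace Kuramoto

noncomputable section

/-- The representative of `θ` modulo `2π` in `(-π, π]`. -/
def rep (θ : ℝ) : ℝ := toIocMod Real.two_pi_pos (-Real.pi) θ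

/-- The orthodromic distance to zero `|θ|_o` over the unit circle. -/
def orthodromic (θ : ℝ) : ℝ := |rep θ|

/-- The singular interaction kernel `h(θ) = sin θ / |θ|_o ^ (2α)`
(with the value `0` at the multiples of `2π` when `α ≠ 0`). -/
def kernel (α θ : ℝ) : ℝ := Real.sin θ / orthodromic θ ^ (2 * α)

/-- The vector field `H_i(Θ) = Ω_i + (K / N) ∑_j h(θ_j - θ_i)` of the singular weighted
Kuramoto model with `N` oscillators. -/
def field {N : ℕ} (α K : ℝ) (Ω : Fin N → ℝ) (Θ : EuclideanSpace ℝ (Fin N)) :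
    EuclideanSpace ℝ (Fin N) :=
  WithLp.toLp 2 fun i => Ω i + K / (N : ℝ) * ∑ j, kernel α (Θ j - Θ i)

/-- The Filippov set-valued map of a single-valued map `F`:
the intersection, over all `δ > 0` and all Lebesgue-null sets `S`, of the closed convex hulls
of `F (B_δ(x) \ S)`. -/
def filippovMap {N : ℕ} (F : EuclideanSpace ℝ (Fin N) → EuclideanSpace ℝ (Fin N))
    (x : EuclideanSpace ℝ (Fin N)) : Set (EuclideanSpace ℝ (Fin N)) :=
  ⋂ (δ : ℝ) (_ : 0 < δ) (S : Set (EuclideanSpace ℝ (Fin N))) (_ : volume S = 0),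
    closure (convexHull ℝ (F '' (Metric.ball x δ \ S)))

/-- `x` is a global-in-time solution in Filippov's sense of `x' = F(x)`, `x(0) = x₀`:
it is absolutely continuous on every `[0, T]`, starts at `x₀`, and satisfies the differential
inclusion `x'(t) ∈ filippovMap F (x(t))` for almost every `t ≥ 0`.
Only the values `x t` with `t ≥ 0` are meaningful. -/
structure IsFilippovSolution {N : ℕ}
    (F : EuclideanSpace ℝ (Fin N) → EuclideanSpace ℝ (Fin N))
    (x₀ : EuclideanSpace ℝ (Fin N)) (x : ℝ → EuclideanSpace ℝ (Fin N)) : Prop where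
  absolutelyContinuous : ∀ T : ℝ, 0 < T → AbsolutelyContinuousOnInterval x 0 T
  initial : x 0 = x₀
  inclusion : ∀ᵐ t : ℝ, 0 < t → ∃ v ∈ filippovMap F (x t), HasDerivAt x v t

/-- The phase diameter `D(Θ) = max_i θ_i - min_i θ_i`. -/
def phaseDiameter {N : ℕ} (Θ : EuclideanSpace ℝ (Fin N)) : ℝ :=
  (⨆ i, Θ i) - ⨅ i, Θ i

/-- Complete phase synchronization at the finite time `T`:
`|θ_i(t) - θ_j(t)| → 0` as `t → T`, `t < T`, for all `i ≠ j`. -/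
def PhaseSynchronizesAt {N : ℕ} (Θ : ℝ → EuclideanSpace ℝ (Fin N)) (T : ℝ) : Prop :=
  ∀ i j : Fin N, i ≠ j → Tendsto (fun t => |Θ t i - Θ t j|) (𝓝[<] T) (𝓝 0)

end

end Kuramoto

/-! The kernel jumps at 0, so when oscillators collide the Filippov inclusion leaves individual
velocities undetermined. The sum of the interactions over a whole cluster is still controlled:
internal interactions cancel because the kernel is odd, and each oscillator outside the leading
cluster `A` pulls every member back by at least `h(D)`, since `h` decreases on `(0, π)`.
Symmetrically for the trailing cluster `B`. As `|A| + |B| ≤ N`, the mean velocities differ by at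
most `-K h(D)`; the common frequency drops out. This bound holds at all nearby configurations and is
linear in the velocity, so it survives closed convex hulls (`meanGap_filippov_le`).

At almost every time all members of `A` move with the derivative of the maximum, and those of `B`
with that of the minimum. Hence `D' ≤ -K h(D)` (`deriv_phaseDiameter_le`). So `D` is nonincreasing,
its slope is at most `-K h(D(Θ₀))` while it is positive, and it reaches 0 in time and stays there
(`finite_time_extinction`). -/

/-! ### Absolutely continuous functions and finite-time extinction -/

/-- Postcomposition with a Lipschitz map preserves absolute continuity. -/
theorem AbsolutelyContinuousOnInterval.lipschitz_comp {X Y : Type*} [PseudoMetricSpace X]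
    [PseudoMetricSpace Y] {L : NNReal} {g : X → Y} (hg : LipschitzWith L g) {f : ℝ → X} {a b : ℝ}
    (hf : AbsolutelyContinuousOnInterval f a b) :
    AbsolutelyContinuousOnInterval (fun t => g (f t)) a b := by
  rw [absolutelyContinuousOnInterval_iff] at hf ⊢
  intro ε hε
  -- Dividing by `L + 1` covers `L = 0` and makes the final inequality strict.
  obtain ⟨δ, hδ, h⟩ := hf (ε / (L + 1)) (by positivity)
  refine ⟨δ, hδ, fun E hE hEδ => ?_⟩
  have h1 := h E hE hEδ
  calc _ ≤ ∑ i ∈ Finset.range E.1, (L : ℝ) * dist (f (E.2 i).1) (f (E.2 i).2) :=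
        Finset.sum_le_sum fun i _ => hg.dist_le_mul _ _
    _ = L * ∑ i ∈ Finset.range E.1, dist (f (E.2 i).1) (f (E.2 i).2) :=
        (Finset.mul_sum _ _ _).symm
    _ ≤ L * (ε / (L + 1)) := by gcongr
    _ < ε := by
        rw [← mul_div_assoc, div_lt_iff₀ (by positivity)]
        nlinarith

/-- An absolutely continuous function with derivative at most `-c` almost everywhere decreases at
least with slope `c`. -/
theorem AbsolutelyContinuousOnInterval.le_sub_mul {f : ℝ → ℝ} {a b c : ℝ} (hab : a ≤ b)
    (hf : AbsolutelyContinuousOnInterval f a b)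
    (hd : ∀ᵐ t : ℝ, t ∈ Set.Ioo a b → deriv f t ≤ -c) :
    f b ≤ f a - c * (b - a) := by
  have h1 := hf.integral_deriv_eq_sub
  have h2 : ∫ t in a..b, deriv f t ≤ ∫ _ in a..b, -c := by
    refine intervalIntegral.integral_mono_ae_restrict hab hf.intervalIntegrable_deriv
      intervalIntegrable_const ?_
    rw [← Measure.restrict_congr_set Ioo_ae_eq_Icc, Filter.EventuallyLE,
      ae_restrict_iff' measurableSet_Ioo]
    exact hd
  rw [intervalIntegral.integral_const, h1, smul_eq_mul] at h2
  linarith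

namespace Kuramoto

/-- A nonnegative locally absolutely continuous function satisfying `f' ≤ -c(f)` almost everywhere
where `0 < f < R`, with `c` positive and antitone, vanishes from a time at most `f 0 / c (f 0)`
onwards. -/
theorem finite_time_extinction {f c : ℝ → ℝ} {R : ℝ}
    (hf : ∀ T : ℝ, 0 < T → AbsolutelyContinuousOnInterval f 0 T)
    (hf_nonneg : ∀ t, 0 ≤ f t) (hf0 : 0 < f 0) (hf0R : f 0 < R)
    (hc_pos : ∀ r ∈ Set.Ioo 0 R, 0 < c r) (hc_anti : AntitoneOn c (Set.Ioo 0 R))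
    (hd : ∀ᵐ t : ℝ, 0 < t → f t ∈ Set.Ioo 0 R → deriv f t ≤ -c (f t)) :
    ∃ T : ℝ, 0 < T ∧ T ≤ f 0 / c (f 0) ∧ ContinuousAt f T ∧ ∀ t, T ≤ t → f t = 0 := by
  have hac : ∀ s t, 0 ≤ s → s ≤ t → AbsolutelyContinuousOnInterval f s t := fun s t hs hst =>
    (hf (t + 1) (by linarith)).mono (by
      rw [Set.uIcc_of_le hst, Set.uIcc_of_le (by linarith)]
      exact Set.Icc_subset_Icc hs (by linarith))
  have hcont : ∀ s t, 0 ≤ s → s ≤ t → ContinuousOn f (Set.Icc s t) := fun s t hs hst => by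
    simpa only [Set.uIcc_of_le hst] using (hac s t hs hst).continuousOn
  have hd0 : ∀ᵐ t : ℝ, 0 < t → f t < R → deriv f t ≤ -0 := by
    filter_upwards [hd] with t ht h0 hR
    rcases (hf_nonneg t).eq_or_lt with h | h
    -- A zero is a global minimum of the nonnegative `f`, so its derivative vanishes there.
    · have hmin : IsLocalMin f t := Eventually.of_forall fun s => h ▸ hf_nonneg s
      simp [hmin.deriv_eq_zero]
    · have := ht h0 ⟨h, hR⟩
      have := hc_pos _ ⟨h, hR⟩
      linarith
  have hmono : ∀ s t, 0 ≤ s → s ≤ t → (∀ u ∈ Set.Ioo s t, f u < R) → f t ≤ f s := by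
    intro s t hs hst hR
    have := (hac s t hs hst).le_sub_mul hst (c := 0) (by
      filter_upwards [hd0] with u hu hmem
      exact hu (by linarith [hmem.1]) (hR u hmem))
    linarith
  have hle : ∀ t, 0 ≤ t → f t ≤ f 0 := by
    intro t ht
    -- Continuous induction: decay is known only below `R`, and continuity keeps `f` below `R`
    -- slightly past any time at which `f ≤ f 0`.
    have hsub : Set.Icc 0 t ⊆ {u | f u ≤ f 0} := by
      refine IsClosed.Icc_subset_of_forall_exists_gt ?_ (le_refl (f 0)) ?_
      · have := (hcont 0 t le_rfl ht).preimage_isClosed_of_isClosed isClosed_Icc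
          (isClosed_Iic (a := f 0))
        rwa [Set.inter_comm] at this
      · rintro s ⟨hs, hs0, hst⟩ y hy
        have hs' : f s < R := lt_of_le_of_lt hs hf0R
        have hcw : ContinuousWithinAt f (Set.Icc s t) s := hcont s t hs0 hst.le s ⟨le_rfl, hst.le⟩
        have hev : ∀ᶠ u in 𝓝[>] s, f u < R := by
          have := (hcw.mono_of_mem_nhdsWithin (Icc_mem_nhdsGT hst)).tendsto.eventually_lt_const hs'
          exact this
        obtain ⟨z, hz, hzR⟩ := (mem_nhdsGT_iff_exists_Ioo_subset).1 hev
        have hz' : s < z := hz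
        have hy' : s < y := hy
        refine ⟨min y z, ?_, lt_min hy' hz', min_le_left _ _⟩
        exact (hmono s _ hs0 (lt_min hy' hz').le fun u hu =>
          hzR ⟨hu.1, hu.2.trans_le (min_le_right _ _)⟩).trans hs
    exact hsub ⟨ht, le_rfl⟩
  have hanti : ∀ s t, 0 ≤ s → s ≤ t → f t ≤ f s := fun s t hs hst =>
    hmono s t hs hst fun u hu => (hle u (by linarith [hu.1])).trans_lt hf0R
  have hc0 : 0 < c (f 0) := hc_pos _ ⟨hf0, hf0R⟩
  set T := f 0 / c (f 0) with hT
  have hTpos : 0 < T := div_pos hf0 hc0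
  -- If `f T > 0`, monotonicity keeps `f` in `(0, f 0]` up to `T`, where antitonicity of `c` gives
  -- slope at most `-c (f 0)`; this forces `f T ≤ 0`.
  have hfT : f T = 0 := by
    by_contra hne
    have hposT : 0 < f T := lt_of_le_of_ne (hf_nonneg T) (Ne.symm hne)
    have := (hac 0 T le_rfl hTpos.le).le_sub_mul hTpos.le (c := c (f 0)) (by
      filter_upwards [hd] with u hu hmem
      have hm : f u ∈ Set.Ioo 0 R := ⟨hposT.trans_le (hanti u T hmem.1.le hmem.2.le),
        (hle u hmem.1.le).trans_lt hf0R⟩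
      have := hu hmem.1 hm
      have := hc_anti hm ⟨hf0, hf0R⟩ (hle u hmem.1.le)
      linarith)
    have h2 : c (f 0) * (T - 0) = f 0 := by rw [hT, sub_zero]; field_simp
    linarith
  refine ⟨T, hTpos, le_rfl, ?_, fun t ht => ?_⟩
  · exact (hcont 0 (T + 1) le_rfl (by linarith)).continuousAt (Icc_mem_nhds hTpos (by linarith))
  · exact le_antisymm (hfT ▸ hanti T t hTpos.le ht) (hf_nonneg t)

/-! ### Linear bounds on the Filippov map -/

/-- A continuous linear functional on the Filippov map is bounded by any local bound along `F`. -/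
theorem le_of_mem_filippovMap {N : ℕ} {F : EuclideanSpace ℝ (Fin N) → EuclideanSpace ℝ (Fin N)}
    {x v : EuclideanSpace ℝ (Fin N)} (hv : v ∈ filippovMap F x)
    (L : EuclideanSpace ℝ (Fin N) →L[ℝ] ℝ) {c : ℝ} (h : ∀ᶠ y in 𝓝 x, L (F y) ≤ c) : L v ≤ c := by
  obtain ⟨δ, hδ, hball⟩ := Metric.eventually_nhds_iff_ball.1 h
  simp only [filippovMap, Set.mem_iInter] at hv
  -- The bound holds on the whole ball, so no null set need be removed.
  have hv' := hv δ hδ ∅ (by simp)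
  refine closure_minimal (convexHull_min ?_ (convex_halfSpace_le L.toLinearMap.isLinear c))
    (isClosed_le L.continuous continuous_const) hv'
  rintro _ ⟨y, hy, rfl⟩
  exact hball y hy.1

/-! ### Maximum, minimum and diameter of the phases -/

theorem lipschitzWith_iSup_coord {N : ℕ} [NeZero N] :
    LipschitzWith 1 (fun x : EuclideanSpace ℝ (Fin N) => ⨆ i, x i) := by
  refine LipschitzWith.of_le_add fun x y => ciSup_le fun i => ?_
  have h1 : y i ≤ ⨆ j, y j := le_ciSup (f := fun j => y j) (Set.finite_range _).bddAbove i
  have h2 : |x i - y i| ≤ dist x y := by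
    rw [dist_eq_norm]; simpa using PiLp.norm_apply_le (x - y) i
  linarith [le_abs_self (x i - y i)]

theorem iInf_coord_eq_neg_iSup {N : ℕ} (x : EuclideanSpace ℝ (Fin N)) :
    ⨅ i, x i = -⨆ i, (-x) i := by
  simp [iSup, iInf, Real.sInf_def, ← Set.image_neg_eq_neg, ← Set.range_comp, Function.comp_def]

theorem lipschitzWith_iInf_coord {N : ℕ} [NeZero N] :
    LipschitzWith 1 (fun x : EuclideanSpace ℝ (Fin N) => ⨅ i, x i) := by
  simp only [iInf_coord_eq_neg_iSup]
  refine LipschitzWith.of_dist_le_mul fun x y => ?_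
  rw [dist_neg_neg]
  simpa using (lipschitzWith_iSup_coord (N := N)).dist_le_mul (-x) (-y)

theorem coord_le_iSup {N : ℕ} (x : EuclideanSpace ℝ (Fin N)) (i : Fin N) : x i ≤ ⨆ j, x j :=
  le_ciSup (f := fun j => x j) (Set.finite_range _).bddAbove i

theorem iInf_le_coord {N : ℕ} (x : EuclideanSpace ℝ (Fin N)) (i : Fin N) : ⨅ j, x j ≤ x i :=
  ciInf_le (f := fun j => x j) (Set.finite_range _).bddBelow i

theorem sub_le_phaseDiameter {N : ℕ} (x : EuclideanSpace ℝ (Fin N)) (i j : Fin N) :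
    x i - x j ≤ phaseDiameter x :=
  sub_le_sub (coord_le_iSup x i) (iInf_le_coord x j)

theorem continuous_phaseDiameter {N : ℕ} [NeZero N] :
    Continuous (phaseDiameter : EuclideanSpace ℝ (Fin N) → ℝ) :=
  lipschitzWith_iSup_coord.continuous.sub lipschitzWith_iInf_coord.continuous

theorem phaseDiameter_neg {N : ℕ} (x : EuclideanSpace ℝ (Fin N)) :
    phaseDiameter (-x) = phaseDiameter x := by
  simp only [phaseDiameter, iInf_coord_eq_neg_iSup, neg_neg]
  ring

theorem phaseDiameter_nonneg {N : ℕ} [NeZero N] (x : EuclideanSpace ℝ (Fin N)) :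
    0 ≤ phaseDiameter x := by
  simpa using sub_le_phaseDiameter x 0 0

/-! ### The critical kernel below `π` -/

theorem kernel_half_of_abs_lt {θ : ℝ} (h : |θ| < Real.pi) :
    kernel (1 / 2) θ = Real.sin θ / |θ| := by
  have h' := abs_lt.1 h
  have : rep θ = θ := (toIocMod_eq_self _).2 ⟨h'.1, by linarith [h'.2]⟩
  simp [kernel, orthodromic, this]

theorem kernel_half_neg {θ : ℝ} (h : |θ| < Real.pi) :
    kernel (1 / 2) (-θ) = -kernel (1 / 2) θ := by
  rw [kernel_half_of_abs_lt h, kernel_half_of_abs_lt (by rwa [abs_neg]), Real.sin_neg, abs_neg,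
    neg_div]

theorem kernel_half_of_mem_Ioo {θ : ℝ} (h : θ ∈ Set.Ioo 0 Real.pi) :
    kernel (1 / 2) θ = Real.sin θ / θ := by
  have : |θ| = θ := abs_of_pos h.1
  rw [kernel_half_of_abs_lt (by rw [this]; exact h.2), this]

theorem kernel_half_pos {θ : ℝ} (h : θ ∈ Set.Ioo 0 Real.pi) : 0 < kernel (1 / 2) θ := by
  rw [kernel_half_of_mem_Ioo h]
  exact div_pos (Real.sin_pos_of_mem_Ioo h) h.1

/-- Since sine is concave on `[0, π]` and vanishes at 0, its chords from the origin have decreasing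
slope. -/
theorem kernel_half_antitoneOn : AntitoneOn (kernel (1 / 2)) (Set.Ioo 0 Real.pi) := by
  intro a ha b hb hab
  rw [kernel_half_of_mem_Ioo ha, kernel_half_of_mem_Ioo hb, div_le_div_iff₀ hb.1 ha.1]
  have hconc := strictConcaveOn_sin_Icc.concaveOn.2
    (⟨le_rfl, Real.pi_pos.le⟩ : (0 : ℝ) ∈ Set.Icc 0 Real.pi) (Set.Ioo_subset_Icc_self hb)
    (sub_nonneg.2 ((div_le_one hb.1).2 hab)) (div_nonneg ha.1.le hb.1.le) (sub_add_cancel 1 _)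
  have hbne := hb.1.ne'
  simp only [smul_eq_mul, mul_zero, Real.sin_zero, zero_add, div_mul_cancel₀ _ hbne] at hconc
  rw [div_mul_eq_mul_div, div_le_iff₀ hb.1] at hconc
  linarith

theorem continuousAt_kernel_half {θ : ℝ} (h : θ ∈ Set.Ioo 0 Real.pi) :
    ContinuousAt (kernel (1 / 2)) θ := by
  have hc : ContinuousAt (fun t : ℝ => Real.sin t / t) θ :=
    Real.continuous_sin.continuousAt.div continuousAt_id h.1.ne'
  refine hc.congr ?_
  filter_upwards [isOpen_Ioo.mem_nhds h] with t ht
  exact (kernel_half_of_mem_Ioo ht).symm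

/-! ### Velocity gap between leading and trailing clusters -/

/-- The interactions inside a cluster cancel, and those with the oscillators behind it pull it
backwards. -/
theorem sum_kernel_le_of_leading {N : ℕ} {y : EuclideanSpace ℝ (Fin N)}
    (hy : phaseDiameter y < Real.pi) (C : Finset (Fin N))
    (hC : ∀ i ∈ C, ∀ j ∉ C, y j < y i) :
    ∑ i ∈ C, ∑ j, kernel (1 / 2) (y j - y i) ≤
      -((C.card : ℝ) * ((N : ℝ) - C.card) * kernel (1 / 2) (phaseDiameter y)) := by
  have habs : ∀ i j, |y i - y j| < Real.pi := fun i j =>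
    (abs_sub_le_iff.2 ⟨sub_le_phaseDiameter y i j, sub_le_phaseDiameter y j i⟩).trans_lt hy
  have hodd : ∀ i j, kernel (1 / 2) (y j - y i) = -kernel (1 / 2) (y i - y j) := fun i j => by
    rw [← kernel_half_neg (habs i j), neg_sub]
  have hin : ∑ i ∈ C, ∑ j ∈ C, kernel (1 / 2) (y j - y i) = 0 := by
    -- Swapping the indices and using oddness shows that the sum equals its own negative.
    have h1 : ∑ i ∈ C, ∑ j ∈ C, kernel (1 / 2) (y j - y i) =
        -∑ i ∈ C, ∑ j ∈ C, kernel (1 / 2) (y j - y i) := by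
      conv_rhs => rw [Finset.sum_comm]
      simp only [← Finset.sum_neg_distrib]
      exact Finset.sum_congr rfl fun i _ => Finset.sum_congr rfl fun j _ => hodd i j
    linarith
  have hout : ∀ i ∈ C, ∀ j ∈ Cᶜ,
      kernel (1 / 2) (y j - y i) ≤ -kernel (1 / 2) (phaseDiameter y) := by
    intro i hi j hj
    have hlt := hC i hi j (Finset.mem_compl.1 hj)
    have hle := sub_le_phaseDiameter y i j
    rw [hodd, neg_le_neg_iff]
    exact kernel_half_antitoneOn ⟨by linarith, by linarith⟩ ⟨by linarith, hy⟩ hle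
  have hcard : ((Cᶜ.card : ℕ) : ℝ) = (N : ℝ) - C.card := by
    rw [Finset.card_compl, Fintype.card_fin, Nat.cast_sub (by simpa using C.card_le_univ)]
  calc ∑ i ∈ C, ∑ j, kernel (1 / 2) (y j - y i)
      = ∑ i ∈ C, ∑ j ∈ C, kernel (1 / 2) (y j - y i) +
          ∑ i ∈ C, ∑ j ∈ Cᶜ, kernel (1 / 2) (y j - y i) := by
        rw [← Finset.sum_add_distrib]
        exact Finset.sum_congr rfl fun i _ => (Finset.sum_add_sum_compl C _).symm
    _ ≤ 0 + ∑ i ∈ C, ∑ j ∈ Cᶜ, -kernel (1 / 2) (phaseDiameter y) := by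
        rw [hin]
        gcongr with i hi j hj
        exact hout i hi j hj
    _ = _ := by
        simp only [Finset.sum_const, nsmul_eq_mul, hcard]
        ring

/-- The reflection `y ↦ -y` turns a trailing cluster into a leading one and preserves the diameter.
-/
theorem le_sum_kernel_of_trailing {N : ℕ} {y : EuclideanSpace ℝ (Fin N)}
    (hy : phaseDiameter y < Real.pi) (C : Finset (Fin N))
    (hC : ∀ i ∈ C, ∀ j ∉ C, y i < y j) :
    (C.card : ℝ) * ((N : ℝ) - C.card) * kernel (1 / 2) (phaseDiameter y) ≤
      ∑ i ∈ C, ∑ j, kernel (1 / 2) (y j - y i) := by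
  have h := sum_kernel_le_of_leading (y := -y) (by rwa [phaseDiameter_neg]) C
    (fun i hi j hj => by simpa using hC i hi j hj)
  rw [phaseDiameter_neg, ← neg_le_neg_iff, neg_neg, ← Finset.sum_neg_distrib] at h
  refine h.trans (Finset.sum_le_sum fun i _ => ?_)
  rw [← Finset.sum_neg_distrib]
  refine Finset.sum_le_sum fun j _ => ?_
  have habs : |y j - y i| < Real.pi :=
    (abs_sub_le_iff.2 ⟨sub_le_phaseDiameter y j i, sub_le_phaseDiameter y i j⟩).trans_lt hy
  have : (-y) j - (-y) i = -(y j - y i) := by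
    simp only [PiLp.neg_apply]
    ring
  rw [this, kernel_half_neg habs, neg_neg]

/-- The difference of the mean values of the coordinates over two finite sets of indices. -/
noncomputable def meanGap {N : ℕ} (A B : Finset (Fin N)) : EuclideanSpace ℝ (Fin N) →L[ℝ] ℝ :=
  (A.card : ℝ)⁻¹ • ∑ i ∈ A, EuclideanSpace.proj i - (B.card : ℝ)⁻¹ • ∑ i ∈ B, EuclideanSpace.proj i

theorem meanGap_apply {N : ℕ} (A B : Finset (Fin N)) (v : EuclideanSpace ℝ (Fin N)) :
    meanGap A B v = (A.card : ℝ)⁻¹ * ∑ i ∈ A, v i - (B.card : ℝ)⁻¹ * ∑ i ∈ B, v i := by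
  simp [meanGap]

theorem meanGap_of_const {N : ℕ} {A B : Finset (Fin N)} (hA : A.Nonempty) (hB : B.Nonempty)
    {v : EuclideanSpace ℝ (Fin N)} {a b : ℝ} (ha : ∀ i ∈ A, v i = a) (hb : ∀ i ∈ B, v i = b) :
    meanGap A B v = a - b := by
  have hA' : (A.card : ℝ) ≠ 0 := by exact_mod_cast hA.card_pos.ne'
  have hB' : (B.card : ℝ) ≠ 0 := by exact_mod_cast hB.card_pos.ne'
  rw [meanGap_apply, Finset.sum_congr rfl ha, Finset.sum_congr rfl hb]
  simp [hA', hB']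

/-- The gap between the mean velocities of the leading and of the trailing cluster. -/
theorem meanGap_field_le {N : ℕ} {K : ℝ} (hK : 0 < K) {Ω : Fin N → ℝ} (hΩ : ∀ i j, Ω i = Ω j)
    {y : EuclideanSpace ℝ (Fin N)} (hy : phaseDiameter y ∈ Set.Ioo 0 Real.pi)
    {A B : Finset (Fin N)} (hA : A.Nonempty) (hB : B.Nonempty) (hAB : Disjoint A B)
    (hA' : ∀ i ∈ A, ∀ j ∉ A, y j < y i) (hB' : ∀ i ∈ B, ∀ j ∉ B, y i < y j) :
    meanGap A B (field (1 / 2) K Ω y) ≤ -(K * kernel (1 / 2) (phaseDiameter y)) := by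
  obtain ⟨i₀, -⟩ := id hA
  have hN : (0 : ℝ) < N := by exact_mod_cast i₀.pos
  have hcA : (0 : ℝ) < A.card := by exact_mod_cast hA.card_pos
  have hcB : (0 : ℝ) < B.card := by exact_mod_cast hB.card_pos
  have hcard : (A.card : ℝ) + B.card ≤ N := by
    have := (A ∪ B).card_le_univ
    rw [Finset.card_union_of_disjoint hAB, Fintype.card_fin] at this
    exact_mod_cast this
  have hsum : ∀ C : Finset (Fin N), ∑ i ∈ C, field (1 / 2) K Ω y i =
      C.card * Ω i₀ + K / N * ∑ i ∈ C, ∑ j, kernel (1 / 2) (y j - y i) := by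
    intro C
    simp only [field, Finset.sum_add_distrib, Finset.mul_sum]
    rw [Finset.sum_congr rfl fun i _ => hΩ i i₀]
    simp
  set k := kernel (1 / 2) (phaseDiameter y) with hk
  have hkpos : 0 < k := kernel_half_pos hy
  have h1 : (A.card : ℝ)⁻¹ * ∑ i ∈ A, ∑ j, kernel (1 / 2) (y j - y i) ≤ -((N - A.card) * k) := by
    rw [inv_mul_le_iff₀ hcA]
    exact (sum_kernel_le_of_leading hy.2 A hA').trans_eq (by ring)
  have h2 : (N - B.card) * k ≤ (B.card : ℝ)⁻¹ * ∑ i ∈ B, ∑ j, kernel (1 / 2) (y j - y i) := by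
    rw [le_inv_mul_iff₀ hcB]
    exact (le_sum_kernel_of_trailing hy.2 B hB').trans_eq' (by ring)
  rw [meanGap_apply, hsum, hsum]
  calc _ = K / N * ((A.card : ℝ)⁻¹ * ∑ i ∈ A, ∑ j, kernel (1 / 2) (y j - y i) -
          (B.card : ℝ)⁻¹ * ∑ i ∈ B, ∑ j, kernel (1 / 2) (y j - y i)) := by
        field_simp
        ring
    -- Here `(N - |A|) + (N - |B|) ≥ N`, as the clusters are disjoint.
    _ ≤ K / N * (-(N * k)) := by
        gcongr
        nlinarith
    _ = _ := by field_simp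

/-- The dissipation of the phase diameter along the Filippov map. -/
theorem meanGap_filippov_le {N : ℕ} {K : ℝ} (hK : 0 < K) {Ω : Fin N → ℝ}
    (hΩ : ∀ i j, Ω i = Ω j) {x v : EuclideanSpace ℝ (Fin N)}
    (hx : phaseDiameter x ∈ Set.Ioo 0 Real.pi) (hv : v ∈ filippovMap (field (1 / 2) K Ω) x)
    {A B : Finset (Fin N)} (hA : A.Nonempty) (hB : B.Nonempty) (hAB : Disjoint A B)
    (hA' : ∀ i ∈ A, ∀ j ∉ A, x j < x i) (hB' : ∀ i ∈ B, ∀ j ∉ B, x i < x j) :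
    meanGap A B v ≤ -(K * kernel (1 / 2) (phaseDiameter x)) := by
  obtain ⟨i₀, -⟩ := id hA
  have : NeZero N := ⟨i₀.pos.ne'⟩
  have hcoord : ∀ i, Continuous fun y : EuclideanSpace ℝ (Fin N) => y i := fun i =>
    (EuclideanSpace.proj i : EuclideanSpace ℝ (Fin N) →L[ℝ] ℝ).continuous
  have hev : ∀ i j, x i < x j → ∀ᶠ y in 𝓝 x, y i < y j := fun i j hij =>
    (hcoord i).continuousAt.eventually_lt (hcoord j).continuousAt hij
  have hevA : ∀ᶠ y in 𝓝 x, ∀ i ∈ A, ∀ j ∉ A, y j < y i := by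
    simp only [eventually_all]
    exact fun i hi j hj => hev j i (hA' i hi j hj)
  have hevB : ∀ᶠ y in 𝓝 x, ∀ i ∈ B, ∀ j ∉ B, y i < y j := by
    simp only [eventually_all]
    exact fun i hi j hj => hev i j (hB' i hi j hj)
  have hD : ContinuousAt (phaseDiameter : EuclideanSpace ℝ (Fin N) → ℝ) x :=
    continuous_phaseDiameter.continuousAt
  have hker : ContinuousAt
      (fun y : EuclideanSpace ℝ (Fin N) => -(K * kernel (1 / 2) (phaseDiameter y))) x :=
    (continuousAt_const.mul ((continuousAt_kernel_half hx).comp hD)).neg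
  -- The bound at nearby `y` involves `D(y)`, so continuity gives it at `x` up to arbitrarily small
  -- slack.
  refine le_of_forall_gt_imp_ge_of_dense fun c hc => le_of_mem_filippovMap hv _ ?_
  filter_upwards [hevA, hevB, hD.eventually (isOpen_Ioo.mem_nhds hx),
    hker.eventually_lt continuousAt_const hc] with y h1 h2 h3 h4
  exact (meanGap_field_le hK hΩ h3 hA hB hAB h1 h2).trans h4.le

/-- Along a Filippov solution the phase diameter decreases at rate at least `K h(D)`. -/
theorem deriv_phaseDiameter_le {N : ℕ} [NeZero N] {K : ℝ} (hK : 0 < K) {Ω : Fin N → ℝ}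
    (hΩ : ∀ i j, Ω i = Ω j) {x : ℝ → EuclideanSpace ℝ (Fin N)} {v : EuclideanSpace ℝ (Fin N)}
    {t : ℝ} (hv : v ∈ filippovMap (field (1 / 2) K Ω) (x t)) (hx : HasDerivAt x v t)
    (hsup : DifferentiableAt ℝ (fun s => ⨆ i, x s i) t)
    (hinf : DifferentiableAt ℝ (fun s => ⨅ i, x s i) t)
    (hD : phaseDiameter (x t) ∈ Set.Ioo 0 Real.pi) :
    deriv (fun s => phaseDiameter (x s)) t ≤ -(K * kernel (1 / 2) (phaseDiameter (x t))) := by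
  have hcoord : ∀ i, HasDerivAt (fun s => x s i) (v i) t := fun i =>
    (EuclideanSpace.proj i : EuclideanSpace ℝ (Fin N) →L[ℝ] ℝ).hasFDerivAt.comp_hasDerivAt t hx
  obtain ⟨a, ha⟩ := exists_eq_ciSup_of_finite (f := fun i => x t i)
  obtain ⟨b, hb⟩ := exists_eq_ciInf_of_finite (f := fun i => x t i)
  have hderiv : deriv (fun s => phaseDiameter (x s)) t =
      deriv (fun s => ⨆ i, x s i) t - deriv (fun s => ⨅ i, x s i) t :=
    (hsup.hasDerivAt.sub hinf.hasDerivAt).deriv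
  set A := Finset.univ.filter fun i => x t i = ⨆ j, x t j with hAdef
  set B := Finset.univ.filter fun i => x t i = ⨅ j, x t j with hBdef
  have hvA : ∀ i ∈ A, v i = deriv (fun s => ⨆ j, x s j) t := by
    intro i hi
    have hi' : x t i = ⨆ j, x t j := by simpa [A] using hi
    -- The nonnegative gap to the maximum vanishes at `t`, so both derivatives agree.
    have hmin : IsLocalMin (fun s => (⨆ j, x s j) - x s i) t := Eventually.of_forall fun s => by
      have := coord_le_iSup (x s) i
      simp only [hi', sub_self, sub_nonneg, this]
    linarith [hmin.hasDerivAt_eq_zero (hsup.hasDerivAt.sub (hcoord i))]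
  have hvB : ∀ i ∈ B, v i = deriv (fun s => ⨅ j, x s j) t := by
    intro i hi
    have hi' : x t i = ⨅ j, x t j := by simpa [B] using hi
    have hmin : IsLocalMin (fun s => x s i - ⨅ j, x s j) t := Eventually.of_forall fun s => by
      have := iInf_le_coord (x s) i
      simp only [hi', sub_self, sub_nonneg, this]
    linarith [hmin.hasDerivAt_eq_zero ((hcoord i).sub hinf.hasDerivAt)]
  have hAne : A.Nonempty := ⟨a, by simpa [A] using ha⟩
  have hBne : B.Nonempty := ⟨b, by simpa [B] using hb⟩
  have hpos : ⨅ j, x t j < ⨆ j, x t j := sub_pos.1 hD.1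
  rw [hderiv, ← meanGap_of_const hAne hBne hvA hvB]
  refine meanGap_filippov_le hK hΩ hD hv hAne hBne ?_ ?_ ?_
  · rw [Finset.disjoint_left]
    intro i hi hi'
    simp only [A, B, Finset.mem_filter, Finset.mem_univ, true_and] at hi hi'
    exact hpos.ne (hi' ▸ hi)
  · intro i hi j hj
    simp only [A, Finset.mem_filter, Finset.mem_univ, true_and] at hi hj
    rw [hi]
    exact lt_of_le_of_ne (coord_le_iSup (x t) j) hj
  · intro i hi j hj
    simp only [B, Finset.mem_filter, Finset.mem_univ, true_and] at hi hj
    rw [hi]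
    exact lt_of_le_of_ne (iInf_le_coord (x t) j) (Ne.symm hj)

end Kuramoto

/-! ### Finite-time synchronization -/

theorem mainTheorem10 (N : ℕ) (K : ℝ) (hK : 0 < K)
    (Ω : Fin N → ℝ) (hΩ : ∀ i j, Ω i = Ω j)
    (Θ₀ : EuclideanSpace ℝ (Fin N))
    (hD_pos : 0 < Kuramoto.phaseDiameter Θ₀)
    (hD_lt : Kuramoto.phaseDiameter Θ₀ < Real.pi)
    (Θ : ℝ → EuclideanSpace ℝ (Fin N))
    (hΘ : Kuramoto.IsFilippovSolution (Kuramoto.field (1 / 2) K Ω) Θ₀ Θ) :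
    ∃ T : ℝ, 0 < T ∧
      T ≤ Kuramoto.phaseDiameter Θ₀ /
        (K * Kuramoto.kernel (1 / 2) (Kuramoto.phaseDiameter Θ₀)) ∧
      Kuramoto.PhaseSynchronizesAt Θ T ∧
      ∀ t : ℝ, T ≤ t → ∀ i j : Fin N, Θ t i = Θ t j := by
  -- For `N = 0` the empty supremum and infimum are both 0, contradicting a positive diameter.
  have : NeZero N := ⟨by
    rintro rfl
    simp [Kuramoto.phaseDiameter] at hD_pos⟩
  have hsup : ∀ T : ℝ, 0 < T → AbsolutelyContinuousOnInterval (fun t => ⨆ i, Θ t i) 0 T :=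
    fun T hT => AbsolutelyContinuousOnInterval.lipschitz_comp
      Kuramoto.lipschitzWith_iSup_coord (hΘ.absolutelyContinuous T hT)
  have hinf : ∀ T : ℝ, 0 < T → AbsolutelyContinuousOnInterval (fun t => ⨅ i, Θ t i) 0 T :=
    fun T hT => AbsolutelyContinuousOnInterval.lipschitz_comp
      Kuramoto.lipschitzWith_iInf_coord (hΘ.absolutelyContinuous T hT)
  have hdiff : ∀ f : ℝ → ℝ, (∀ T : ℝ, 0 < T → AbsolutelyContinuousOnInterval f 0 T) →
      ∀ᵐ t : ℝ, 0 < t → DifferentiableAt ℝ f t := by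
    intro f hf
    have h : ∀ᵐ t : ℝ, ∀ n : ℕ, t ∈ Set.uIcc (0 : ℝ) (n + 1) → DifferentiableAt ℝ f t :=
      ae_all_iff.2 fun n => (hf (n + 1) (by positivity)).ae_differentiableAt
    filter_upwards [h] with t ht h0
    obtain ⟨n, hn⟩ := exists_nat_ge t
    exact ht n (by rw [Set.uIcc_of_le (by positivity)]; exact ⟨h0.le, by linarith⟩)
  have h0 : Kuramoto.phaseDiameter (Θ 0) = Kuramoto.phaseDiameter Θ₀ := by rw [hΘ.initial]
  obtain ⟨T, hT, hTle, hcont, hzero⟩ := Kuramoto.finite_time_extinction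
    (f := fun t => Kuramoto.phaseDiameter (Θ t)) (c := fun r => K * Kuramoto.kernel (1 / 2) r)
    (R := Real.pi) (fun T hT => (hsup T hT).sub (hinf T hT))
    (fun t => Kuramoto.phaseDiameter_nonneg _) (by rwa [h0]) (by rwa [h0])
    (fun r hr => mul_pos hK (Kuramoto.kernel_half_pos hr))
    (fun a ha b hb hab => mul_le_mul_of_nonneg_left
      (Kuramoto.kernel_half_antitoneOn ha hb hab) hK.le)
    (by
      filter_upwards [hΘ.inclusion, hdiff _ hsup, hdiff _ hinf] with t ht h1 h2 hpos hmem
      obtain ⟨v, hv, hderiv⟩ := ht hpos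
      exact Kuramoto.deriv_phaseDiameter_le hK hΩ hv hderiv (h1 hpos) (h2 hpos) hmem)
  simp only [h0] at hTle
  have habs : ∀ t i j, |Θ t i - Θ t j| ≤ Kuramoto.phaseDiameter (Θ t) := fun t i j =>
    abs_sub_le_iff.2
      ⟨Kuramoto.sub_le_phaseDiameter _ i j, Kuramoto.sub_le_phaseDiameter _ j i⟩
  refine ⟨T, hT, hTle, fun i j _ => ?_, fun t ht i j => ?_⟩
  · have hlim : Tendsto (fun t => Kuramoto.phaseDiameter (Θ t)) (𝓝[<] T) (𝓝 0) := by
      have := hcont.tendsto.mono_left (nhdsWithin_le_nhds (s := Set.Iio T))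
      rwa [hzero T le_rfl] at this
    exact squeeze_zero (fun t => abs_nonneg _) (fun t => habs t i j) hlim
  · have := habs t i j
    rw [hzero t ht] at this
    exact sub_eq_zero.1 (abs_nonpos_iff.1 this)
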